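/- All graphs here are finite and simple. The matching polynomial of a graph $G=(V,E)$ is $$M(G,x,y)=\sum_{A} x^{\mathrm{def}(G,A)}\,y^{|A|},$$ where $A$ runs over the matchings of $G$ (sets of pairwise disjoint edges) and $\mathrm{def}(G,A)$ is the number of vertices of $G$ that lie on no edge of $A$. The polynomial deck of $G$ is the multiset of the polynomials $M(G_{-v},x,y)$, $v\in V$, where $G_{-v}$ arises from $G$ by deleting the vertex $v$. The matching polynomial of $G$ is called polynomial reconstructible if every graph with the same polynomial deck as $G$ has the same matching polynomial as $G$. Let $C_n$ denote the cycle on $n$ vertices, $\sqcup$ the disjoint union and $\overline{G}$ the complement of $G$. Theorem. Let $k\ge 3$. Then $C_{2k}$ and $C_k\sqcup C_k$ have the same polynomial deck but different matching polynomials, and likewise $\overline{C_{2k}}$ and $\overline{C_k\sqcup C_k}$ have the same polynomial deck but different matching polynomials. In particular, the matching polynomials of the four graphs $C_{2k}$, $C_k\sqcup C_k$, $\overline{C_{2k}}$, $\overline{C_k\sqcup C_k}$ are not polynomial reconstructible. -/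

import Mathlib

namespace SimpleGraph

/-- A finite set `A` of unordered pairs is a matching in `G`: it consists of edges of `G`, and no
vertex lies on two different members of `A`. -/
def IsEdgeMatching {V : Type*} (G : SimpleGraph V) (A : Finset (Sym2 V)) : Prop :=
  (∀ e ∈ A, e ∈ G.edgeSet) ∧ ∀ e ∈ A, ∀ f ∈ A, e ≠ f → ∀ v : V, ¬ (v ∈ e ∧ v ∈ f)

open Classical in
/-- The number of vertices that lie on none of the edges in `A`. -/
noncomputable def matchingDefect {V : Type*} [Fintype V] (A : Finset (Sym2 V)) : ℕ :=
  (Finset.univ.filter fun v : V => ∀ e ∈ A, v ∉ e).card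

open Classical in
/-- The bivariate matching polynomial: the sum of `x ^ def(A) * y ^ |A|` over all matchings `A`
of `G`, where `x = X 0`, `y = X 1`. -/
noncomputable def matchingPolynomial {V : Type*} [Fintype V] (G : SimpleGraph V) :
    MvPolynomial (Fin 2) ℤ :=
  ∑ A ∈ (Finset.univ : Finset (Finset (Sym2 V))).filter (fun A => G.IsEdgeMatching A),
    MvPolynomial.X 0 ^ matchingDefect A * MvPolynomial.X 1 ^ A.card

open Classical in
/-- The polynomial deck: the multiset of the matching polynomials of the vertex-deleted subgraphs
of `G`, one for every vertex. -/
noncomputable def matchingPolynomialDeck {V : Type*} [Fintype V] (G : SimpleGraph V) :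
    Multiset (MvPolynomial (Fin 2) ℤ) :=
  (Finset.univ : Finset V).val.map fun v => (G.induce ({v}ᶜ : Set V)).matchingPolynomial

/-- The matching polynomial of `G` is determined by the polynomial deck of `G`: every finite simple
graph with the same polynomial deck has the same matching polynomial. -/
def IsMatchingPolynomialReconstructible {V : Type*} [Fintype V] (G : SimpleGraph V) : Prop :=
  ∀ (W : Type) [Fintype W] (H : SimpleGraph W),
    H.matchingPolynomialDeck = G.matchingPolynomialDeck →
      H.matchingPolynomial = G.matchingPolynomial

end SimpleGraph

/-! Deleting a vertex from `C_{2k}` leaves a path on `2k-1` vertices; deleting one from `C_k ⊔ C_k`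
leaves `C_k` and a path on `k-1` vertices. Path and cycle polynomials behave like Fibonacci and
Lucas numbers. The analogue of `F_{2k} = L_k F_k` (`pathMatchingPolynomial_two_mul`) makes the decks
equal, and that of `L_k² = L_{2k} + 2(-1)^k` (`matchingPolynomial_cycleGraph_sq`) shows that the
polynomials differ by `2(-y)^k ≠ 0`.

For complements, one linear map, sending `x^i y^j` to `(-y)^j` times the polynomial of the complete
graph on `i` vertices, turns the polynomial of any graph into that of its complement
(`matchingPolynomialOn_compl`). It carries equal decks to equal decks, and complementing twice shows
that it cannot merge different matching polynomials. -/

namespace SimpleGraph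

variable {V W : Type*}

/-! ### Matching polynomials of vertex subsets and the vertex recurrence -/

open Classical in
/-- The vertices of `S` that lie on none of the edges in `A`. -/
noncomputable def uncoveredVertices (S : Finset V) (A : Finset (Sym2 V)) : Finset V :=
  S.filter fun v => ∀ e ∈ A, v ∉ e

@[simp]
theorem mem_uncoveredVertices {S : Finset V} {A : Finset (Sym2 V)} {v : V} :
    v ∈ uncoveredVertices S A ↔ v ∈ S ∧ ∀ e ∈ A, v ∉ e := by
  simp [uncoveredVertices]

open Classical in
/-- The matching polynomial of the subgraph of `G` induced on the finite vertex set `S`. -/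
noncomputable def matchingPolynomialOn (G : SimpleGraph V) (S : Finset V) :
    MvPolynomial (Fin 2) ℤ :=
  ∑ A ∈ S.sym2.powerset.filter (fun A => G.IsEdgeMatching A),
    MvPolynomial.X 0 ^ (uncoveredVertices S A).card * MvPolynomial.X 1 ^ A.card

theorem matchingPolynomial_eq_matchingPolynomialOn_univ [Fintype V] (G : SimpleGraph V) :
    G.matchingPolynomial = G.matchingPolynomialOn Finset.univ := by
  classical
  unfold matchingPolynomial matchingPolynomialOn matchingDefect uncoveredVertices
  refine Finset.sum_congr ?_ fun A _ => ?_
  · ext A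
    simp
  · congr!

theorem isEdgeMatching_empty (G : SimpleGraph V) : G.IsEdgeMatching ∅ := by
  simp [IsEdgeMatching]

theorem matchingPolynomialOn_empty (G : SimpleGraph V) : G.matchingPolynomialOn ∅ = 1 := by
  classical
  unfold matchingPolynomialOn
  rw [Finset.sym2_empty, Finset.powerset_empty, Finset.filter_singleton,
    if_pos (isEdgeMatching_empty G)]
  simp [uncoveredVertices]

theorem IsEdgeMatching.mono {G : SimpleGraph V} {A B : Finset (Sym2 V)} (hA : G.IsEdgeMatching A)
    (h : B ⊆ A) : G.IsEdgeMatching B :=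
  ⟨fun e he => hA.1 e (h he), fun e he f hf => hA.2 e (h he) f (h hf)⟩

theorem IsEdgeMatching.notMem_of_mem_erase [DecidableEq V] {G : SimpleGraph V}
    {A : Finset (Sym2 V)} (hA : G.IsEdgeMatching A) {e f : Sym2 V} (he : e ∈ A)
    (hf : f ∈ A.erase e) {w : V} (hw : w ∈ e) : w ∉ f := fun h =>
  hA.2 e he f (Finset.mem_of_mem_erase hf) (Finset.ne_of_mem_erase hf).symm w ⟨hw, h⟩

theorem IsEdgeMatching.insert_edge [DecidableEq V] {G : SimpleGraph V} {B : Finset (Sym2 V)}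
    (hB : G.IsEdgeMatching B) {e : Sym2 V} (he : e ∈ G.edgeSet)
    (h : ∀ f ∈ B, ∀ w ∈ e, w ∉ f) : G.IsEdgeMatching (insert e B) := by
  refine ⟨?_, ?_⟩
  · intro f hf
    rcases Finset.mem_insert.1 hf with rfl | hf
    exacts [he, hB.1 f hf]
  · intro f hf g hg hne w hw
    rcases Finset.mem_insert.1 hf with rfl | hfB <;> rcases Finset.mem_insert.1 hg with rfl | hgB
    · exact hne rfl
    · exact h g hgB w hw.1 hw.2
    · exact h f hfB w hw.2 hw.1
    · exact hB.2 f hfB g hgB hne w hw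

/-- Vertex recurrence for the matching polynomial. -/
theorem matchingPolynomialOn_eq_add_sum [DecidableEq V] (G : SimpleGraph V) [DecidableRel G.Adj]
    {S : Finset V} {v : V} (hv : v ∈ S) :
    G.matchingPolynomialOn S = MvPolynomial.X 0 * G.matchingPolynomialOn (S.erase v) +
      MvPolynomial.X 1 * ∑ u ∈ S.erase v with G.Adj v u,
        G.matchingPolynomialOn ((S.erase v).erase u) := by
  classical
  unfold matchingPolynomialOn
  -- Split the matchings by whether they leave `v` uncovered.
  rw [← Finset.sum_filter_add_sum_filter_not _ (fun A : Finset (Sym2 V) => ∀ e ∈ A, v ∉ e)]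
  congr 1
  · rw [Finset.mul_sum]
    have hset : (S.sym2.powerset.filter (fun A => G.IsEdgeMatching A)).filter
        (fun A => ∀ e ∈ A, v ∉ e) =
        (S.erase v).sym2.powerset.filter (fun A => G.IsEdgeMatching A) := by
      ext A
      simp only [Finset.mem_filter, Finset.mem_powerset, Finset.subset_iff, Finset.mem_sym2_iff,
        Finset.mem_erase]
      constructor
      · rintro ⟨⟨h1, h2⟩, h3⟩
        exact ⟨fun e he w hw => ⟨fun h => h3 e he (h ▸ hw), h1 he w hw⟩, h2⟩
      · rintro ⟨h1, h2⟩
        exact ⟨⟨fun e he w hw => (h1 he w hw).2, h2⟩, fun e he hve => (h1 he v hve).1 rfl⟩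
    rw [hset]
    refine Finset.sum_congr rfl fun A hA => ?_
    simp only [Finset.mem_filter, Finset.mem_powerset, Finset.subset_iff, Finset.mem_sym2_iff,
      Finset.mem_erase] at hA
    have hvA : ∀ e ∈ A, v ∉ e := fun e he hve => (hA.1 he v hve).1 rfl
    have : uncoveredVertices S A = insert v (uncoveredVertices (S.erase v) A) := by
      ext w
      simp only [mem_uncoveredVertices, Finset.mem_insert, Finset.mem_erase]
      by_cases h : w = v
      · subst h
        simpa [hv] using hvA
      · simp [h]
    rw [this, Finset.card_insert_of_notMem (by simp)]
    ring
  · rw [Finset.mul_sum]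
    simp_rw [Finset.mul_sum]
    rw [Finset.sum_sigma']
    symm
    refine Finset.sum_bij (fun p _ => insert s(v, p.1) p.2) ?_ ?_ ?_ ?_
    · rintro ⟨u, B⟩ hp
      simp only [Finset.mem_sigma, Finset.mem_filter, Finset.mem_powerset, Finset.subset_iff,
        Finset.mem_sym2_iff, Finset.mem_erase] at hp ⊢
      obtain ⟨⟨⟨huv, huS⟩, hadj⟩, hB, hM⟩ := hp
      refine ⟨⟨?_, hM.insert_edge hadj ?_⟩, ?_⟩
      · intro e he w hw
        rcases Finset.mem_insert.1 he with rfl | he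
        · rcases Sym2.mem_iff.1 hw with rfl | rfl <;> assumption
        · exact (hB he w hw).2.2
      · intro f hf w hw hwf
        rcases Sym2.mem_iff.1 hw with rfl | rfl
        · exact (hB hf _ hwf).2.1 rfl
        · exact (hB hf _ hwf).1 rfl
      · intro h
        exact h _ (Finset.mem_insert_self _ _) (Sym2.mem_mk_left _ _)
    · rintro ⟨u, B⟩ hp ⟨u', B'⟩ hp' heq
      simp only [Finset.mem_sigma, Finset.mem_filter, Finset.mem_powerset, Finset.subset_iff,
        Finset.mem_sym2_iff, Finset.mem_erase] at hp hp' heq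
      have hvB : ∀ w, s(v, w) ∉ B := fun w h => (hp.2.1 h v (Sym2.mem_mk_left _ _)).2.1 rfl
      have hvB' : ∀ w, s(v, w) ∉ B' := fun w h => (hp'.2.1 h v (Sym2.mem_mk_left _ _)).2.1 rfl
      have h1 : s(v, u) ∈ insert s(v, u') B' := heq ▸ Finset.mem_insert_self _ _
      have huu : u = u' := by
        rcases Finset.mem_insert.1 h1 with h | h
        · exact Sym2.congr_right.1 h
        · exact absurd h (hvB' u)
      subst huu
      have : B = B' := by
        rw [← Finset.erase_insert (hvB u), heq, Finset.erase_insert (hvB' u)]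
      rw [this]
    · intro A hA
      simp only [Finset.mem_filter, Finset.mem_powerset, Finset.subset_iff,
        Finset.mem_sym2_iff] at hA
      obtain ⟨⟨hS, hM⟩, hex⟩ := hA
      push Not at hex
      obtain ⟨e, he, hve⟩ := hex
      obtain ⟨u, rfl⟩ := hve
      have hadj : G.Adj v u := hM.1 _ he
      refine ⟨⟨u, A.erase s(v, u)⟩, ?_, Finset.insert_erase he⟩
      simp only [Finset.mem_sigma, Finset.mem_filter, Finset.mem_powerset, Finset.subset_iff,
        Finset.mem_sym2_iff, Finset.mem_erase (s := S), Finset.mem_erase (s := S.erase v)]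
      refine ⟨⟨⟨hadj.ne', hS he u (Sym2.mem_mk_right _ _)⟩, hadj⟩, ?_,
        hM.mono (Finset.erase_subset _ _)⟩
      intro f hf w hw
      refine ⟨?_, ?_, hS (Finset.mem_of_mem_erase hf) w hw⟩
      · rintro rfl
        exact hM.notMem_of_mem_erase he hf (Sym2.mem_mk_right _ _) hw
      · rintro rfl
        exact hM.notMem_of_mem_erase he hf (Sym2.mem_mk_left _ _) hw
    · rintro ⟨u, B⟩ hp
      simp only [Finset.mem_sigma, Finset.mem_filter, Finset.mem_powerset, Finset.subset_iff,
        Finset.mem_sym2_iff, Finset.mem_erase] at hp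
      have hvB : s(v, u) ∉ B := fun h => (hp.2.1 h v (Sym2.mem_mk_left _ _)).2.1 rfl
      have hset : uncoveredVertices S (insert s(v, u) B) =
          uncoveredVertices ((S.erase v).erase u) B := by
        ext w
        simp only [mem_uncoveredVertices, Finset.mem_erase, Finset.forall_mem_insert, Sym2.mem_iff]
        tauto
      rw [hset, Finset.card_insert_of_notMem hvB]
      ring

/-! ### Relabelling, disjoint unions and the deck -/

/-- Adjacency is compared only on `S`, so a cycle without one vertex can be mapped into the infinite
path on `ℕ`. -/
theorem matchingPolynomialOn_image [DecidableEq W] {G : SimpleGraph V} {H : SimpleGraph W}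
    (f : V → W) (S : Finset V) (hinj : Set.InjOn f S)
    (hadj : ∀ a ∈ S, ∀ b ∈ S, H.Adj (f a) (f b) ↔ G.Adj a b) :
    H.matchingPolynomialOn (S.image f) = G.matchingPolynomialOn S := by
  classical
  induction S using Finset.strongInduction with
  | H S ih =>
    rcases S.eq_empty_or_nonempty with rfl | ⟨v, hv⟩
    · simp [matchingPolynomialOn_empty]
    have himg : ∀ T ⊆ S, ∀ u ∈ T, (T.image f).erase (f u) = (T.erase u).image f := by
      intro T hT u hu
      ext w
      simp only [Finset.mem_erase, Finset.mem_image]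
      constructor
      · rintro ⟨hne, a, ha, rfl⟩
        exact ⟨a, ⟨fun h => hne (h ▸ rfl), ha⟩, rfl⟩
      · rintro ⟨a, ⟨hne, ha⟩, rfl⟩
        exact ⟨fun h => hne (hinj (hT ha) (hT hu) h), a, ha, rfl⟩
    have ih' : ∀ T ⊂ S, H.matchingPolynomialOn (T.image f) = G.matchingPolynomialOn T :=
      fun T hT => ih T hT (hinj.mono (Finset.coe_subset.2 hT.subset))
        fun a ha b hb => hadj a (hT.subset ha) b (hT.subset hb)
    rw [matchingPolynomialOn_eq_add_sum H (Finset.mem_image_of_mem f hv),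
      matchingPolynomialOn_eq_add_sum G hv, himg S subset_rfl v hv,
      ih' _ (Finset.erase_ssubset hv), Finset.filter_image, Finset.sum_image]
    · congr 2
      refine Finset.sum_congr ?_ fun u hu => ?_
      · refine Finset.filter_congr fun u hu => ?_
        exact hadj v hv u (Finset.mem_of_mem_erase hu)
      · have hu := (Finset.mem_filter.1 hu).1
        rw [himg _ (Finset.erase_subset _ _) u hu]
        exact ih' _ ((Finset.erase_ssubset hu).trans (Finset.erase_ssubset hv))
    · refine hinj.mono ?_
      intro u hu
      exact Finset.mem_of_mem_erase (Finset.mem_filter.1 hu).1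

theorem matchingPolynomialOn_union [DecidableEq V] (G : SimpleGraph V) (S T : Finset V)
    (hdisj : Disjoint S T) (hadj : ∀ a ∈ S, ∀ b ∈ T, ¬ G.Adj a b) :
    G.matchingPolynomialOn (S ∪ T) = G.matchingPolynomialOn S * G.matchingPolynomialOn T := by
  classical
  induction S using Finset.strongInduction with
  | H S ih =>
    rcases S.eq_empty_or_nonempty with rfl | ⟨v, hv⟩
    · simp [matchingPolynomialOn_empty]
    have ih' : ∀ S' ⊂ S, G.matchingPolynomialOn (S' ∪ T) =
        G.matchingPolynomialOn S' * G.matchingPolynomialOn T := fun S' h =>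
      ih S' h (hdisj.mono_left h.subset) fun a ha => hadj a (h.subset ha)
    have hT : ∀ u ∈ S, u ∉ T := fun u hu => Finset.disjoint_left.1 hdisj hu
    have herase : ∀ S' ⊆ S, ∀ u ∈ S', (S' ∪ T).erase u = S'.erase u ∪ T := fun S' h u hu => by
      rw [Finset.erase_union_distrib, Finset.erase_eq_of_notMem (hT u (h hu))]
    rw [matchingPolynomialOn_eq_add_sum G (Finset.mem_union_left T hv),
      matchingPolynomialOn_eq_add_sum G hv, herase S subset_rfl v hv,
      ih' _ (Finset.erase_ssubset hv), add_mul, mul_assoc, mul_assoc, Finset.sum_mul]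
    congr 2
    have hfilter : (S.erase v ∪ T).filter (G.Adj v) = (S.erase v).filter (G.Adj v) := by
      rw [Finset.filter_union, Finset.filter_eq_empty_iff.2 (fun {u} hu => hadj v hv u hu),
        Finset.union_empty]
    rw [hfilter]
    refine Finset.sum_congr rfl fun u hu => ?_
    have hu := (Finset.mem_filter.1 hu).1
    rw [herase _ (Finset.erase_subset _ _) u hu]
    exact ih' _ ((Finset.erase_ssubset hu).trans (Finset.erase_ssubset hv))

theorem matchingPolynomialOn_sum [DecidableEq V] [DecidableEq W] (G : SimpleGraph V)
    (H : SimpleGraph W) (S : Finset V) (T : Finset W) :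
    (G ⊕g H).matchingPolynomialOn (S.image Sum.inl ∪ T.image Sum.inr) =
      G.matchingPolynomialOn S * H.matchingPolynomialOn T := by
  rw [matchingPolynomialOn_union, matchingPolynomialOn_image (G := G),
    matchingPolynomialOn_image (G := H)]
  · exact Sum.inr_injective.injOn
  · simp
  · exact Sum.inl_injective.injOn
  · simp
  · simp [Finset.disjoint_left]
  · simp

theorem matchingPolynomial_sum [Fintype V] [Fintype W] (G : SimpleGraph V) (H : SimpleGraph W) :
    (G ⊕g H).matchingPolynomial = G.matchingPolynomial * H.matchingPolynomial := by
  classical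
  simp_rw [matchingPolynomial_eq_matchingPolynomialOn_univ]
  rw [← matchingPolynomialOn_sum]
  congr 1
  ext (a | a) <;> simp

theorem matchingPolynomial_induce_compl_singleton [Fintype V] [DecidableEq V]
    (G : SimpleGraph V) (v : V) {_ : Fintype ({v}ᶜ : Set V)} :
    (G.induce ({v}ᶜ : Set V)).matchingPolynomial =
      G.matchingPolynomialOn (Finset.univ.erase v) := by
  rw [matchingPolynomial_eq_matchingPolynomialOn_univ,
    ← matchingPolynomialOn_image (H := G) Subtype.val _ Subtype.val_injective.injOn (by simp)]
  congr 1
  ext w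
  simp

theorem matchingPolynomialDeck_eq_map [Fintype V] [DecidableEq V] (G : SimpleGraph V) :
    G.matchingPolynomialDeck =
      (Finset.univ : Finset V).val.map fun v => G.matchingPolynomialOn (Finset.univ.erase v) := by
  unfold matchingPolynomialDeck
  refine congrArg (fun f => Multiset.map f _) (funext fun v => ?_)
  exact matchingPolynomial_induce_compl_singleton G v

/-! ### The derivative in `x` as the sum of the deck -/

-- Differentiating `x^def` picks an uncovered vertex `v`, and matchings that miss `v` are matchings
-- of `S.erase v`. The proof is by the recurrence: both sides reduce to one double sum over pairs `u
-- ≠ w`, with the order of summation exchanged.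
open MvPolynomial in
theorem pderiv_matchingPolynomialOn [DecidableEq V] (G : SimpleGraph V) (S : Finset V) :
    pderiv 0 (G.matchingPolynomialOn S) = ∑ v ∈ S, G.matchingPolynomialOn (S.erase v) := by
  classical
  induction S using Finset.strongInduction with
  | H S ih =>
    rcases S.eq_empty_or_nonempty with rfl | ⟨v, hv⟩
    · simp [matchingPolynomialOn_empty]
    have h1 : ∀ w ∈ S.erase v, G.matchingPolynomialOn (S.erase w) =
        X 0 * G.matchingPolynomialOn ((S.erase v).erase w) +
          X 1 * ∑ u ∈ S.erase v, if u ≠ w ∧ G.Adj v u then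
            G.matchingPolynomialOn (((S.erase v).erase u).erase w) else 0 := by
      intro w hw
      rw [matchingPolynomialOn_eq_add_sum G
        (Finset.mem_erase.2 ⟨(Finset.ne_of_mem_erase hw).symm, hv⟩), Finset.erase_right_comm,
        ← Finset.sum_filter]
      congr 2
      refine Finset.sum_congr ?_ fun u _ => ?_
      · ext u
        simp only [Finset.mem_filter, Finset.mem_erase]
        tauto
      · rw [Finset.erase_right_comm]
    rw [← Finset.add_sum_erase S _ hv, Finset.sum_congr rfl h1,
      matchingPolynomialOn_eq_add_sum G hv, Finset.sum_add_distrib, ← Finset.mul_sum,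
      ← Finset.mul_sum, ← ih _ (Finset.erase_ssubset hv), Finset.sum_comm]
    simp only [map_add, Derivation.leibniz, map_sum, pderiv_X_self, smul_eq_mul, mul_one,
      pderiv_X_of_ne (show (1 : Fin 2) ≠ 0 by decide), mul_zero, add_zero]
    have h2 : ∑ u ∈ S.erase v with G.Adj v u,
          pderiv 0 (G.matchingPolynomialOn ((S.erase v).erase u)) =
        ∑ u ∈ S.erase v, ∑ w ∈ S.erase v, if u ≠ w ∧ G.Adj v u then
            G.matchingPolynomialOn (((S.erase v).erase u).erase w) else 0 := by
      rw [Finset.sum_filter]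
      refine Finset.sum_congr rfl fun u hu => ?_
      by_cases h : G.Adj v u
      · rw [if_pos h, ih _ ((Finset.erase_ssubset hu).trans (Finset.erase_ssubset hv)),
          ← Finset.add_sum_erase (S.erase v) _ hu]
        simp only [ne_eq, not_true_eq_false, false_and, if_false, zero_add]
        refine Finset.sum_congr rfl fun w hw => ?_
        rw [if_pos ⟨(Finset.ne_of_mem_erase hw).symm, h⟩]
      · simp [h]
    rw [h2]
    ring

/-! ### Complements -/

open MvPolynomial

/-- The matching polynomial of the complete graph on `n` vertices, given by its recurrence. -/
noncomputable def completeMatchingPolynomial : ℕ → MvPolynomial (Fin 2) ℤ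
  | 0 => 1
  | 1 => X 0
  | n + 2 => X 0 * completeMatchingPolynomial (n + 1) +
      ((n + 1 : ℕ) : MvPolynomial (Fin 2) ℤ) * X 1 * completeMatchingPolynomial n

/-- The linear map that takes the matching polynomial of a graph to that of its complement. -/
noncomputable def complMatchingPolynomial :
    MvPolynomial (Fin 2) ℤ →ₗ[ℤ] MvPolynomial (Fin 2) ℤ :=
  (basisMonomials (Fin 2) ℤ).constr ℤ fun s => (-X 1) ^ s 1 * completeMatchingPolynomial (s 0)

theorem complMatchingPolynomial_monomial (s : Fin 2 →₀ ℕ) :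
    complMatchingPolynomial (monomial s 1) =
      (-X 1) ^ s 1 * completeMatchingPolynomial (s 0) := by
  rw [complMatchingPolynomial, ← Module.Basis.constr_basis (basisMonomials (Fin 2) ℤ) ℤ
    (fun s => (-X 1) ^ s 1 * completeMatchingPolynomial (s 0)) s]
  rfl

theorem complMatchingPolynomial_one : complMatchingPolynomial 1 = 1 := by
  have := complMatchingPolynomial_monomial 0
  simpa [completeMatchingPolynomial] using this

theorem complMatchingPolynomial_X_one_mul (p : MvPolynomial (Fin 2) ℤ) :
    complMatchingPolynomial (X 1 * p) = -(X 1 * complMatchingPolynomial p) := by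
  have : complMatchingPolynomial ∘ₗ LinearMap.mulLeft ℤ (X 1) =
      -(LinearMap.mulLeft ℤ (X 1) ∘ₗ complMatchingPolynomial) := by
    refine (basisMonomials (Fin 2) ℤ).ext fun s => ?_
    simp only [coe_basisMonomials, LinearMap.comp_apply, LinearMap.mulLeft_apply,
      LinearMap.neg_apply, X, monomial_mul, mul_one]
    rw [complMatchingPolynomial_monomial, complMatchingPolynomial_monomial]
    simp only [Finsupp.add_apply, Finsupp.single_apply, X]
    simp [add_comm 1, pow_succ]
    ring
  exact LinearMap.congr_fun this p

/-- On monomials this is the recurrence of the complete graphs, whose factor `n` comes from `∂x^n =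
n x^(n-1)`. -/
theorem complMatchingPolynomial_X_zero_mul (p : MvPolynomial (Fin 2) ℤ) :
    complMatchingPolynomial (X 0 * p) =
      X 0 * complMatchingPolynomial p + X 1 * complMatchingPolynomial (pderiv 0 p) := by
  have : complMatchingPolynomial ∘ₗ LinearMap.mulLeft ℤ (X 0) =
      LinearMap.mulLeft ℤ (X 0) ∘ₗ complMatchingPolynomial +
      LinearMap.mulLeft ℤ (X 1) ∘ₗ complMatchingPolynomial ∘ₗ (pderiv 0).toLinearMap := by
    refine (basisMonomials (Fin 2) ℤ).ext fun s => ?_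
    simp only [coe_basisMonomials, LinearMap.comp_apply, LinearMap.mulLeft_apply,
      LinearMap.add_apply, Derivation.coeFn_coe,
      pderiv_monomial, one_mul]
    have hX : (X 0 : MvPolynomial (Fin 2) ℤ) * monomial s 1 =
        monomial (Finsupp.single 0 1 + s) 1 := by
      rw [X, monomial_mul, mul_one]
    have hsmul : monomial (s - Finsupp.single 0 1) ((s 0 : ℕ) : ℤ) =
        ((s 0 : ℕ) : ℤ) • (monomial (s - Finsupp.single 0 1) 1 : MvPolynomial (Fin 2) ℤ) := by
      rw [smul_monomial, smul_eq_mul, mul_one]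
    rw [hX, hsmul, map_smul, complMatchingPolynomial_monomial, complMatchingPolynomial_monomial,
      complMatchingPolynomial_monomial]
    have h1 : (Finsupp.single (0 : Fin 2) 1 + s : Fin 2 →₀ ℕ) 1 = s 1 := by simp
    have h2 : (Finsupp.single (0 : Fin 2) 1 + s : Fin 2 →₀ ℕ) 0 = s 0 + 1 := by simp [add_comm]
    have h3 : (s - Finsupp.single (0 : Fin 2) 1 : Fin 2 →₀ ℕ) 1 = s 1 := by simp
    have h4 : (s - Finsupp.single (0 : Fin 2) 1 : Fin 2 →₀ ℕ) 0 = s 0 - 1 := by simp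
    rw [h1, h2, h3, h4]
    -- At `s 0 = 0` the truncated exponent `s 0 - 1` is harmless, since its coefficient is `0`.
    cases s 0 with
    | zero => simp [completeMatchingPolynomial]; ring
    | succ n =>
      simp only [completeMatchingPolynomial, Nat.add_sub_cancel, zsmul_eq_mul]
      push_cast
      ring
  exact LinearMap.congr_fun this p

/-- In the recurrence at `v`, the derivative term sums over all `u ≠ v`; the neighbour term enters
with the opposite sign and cancels the neighbours, leaving exactly the neighbours of `v` in `Gᶜ`. -/
theorem matchingPolynomialOn_compl (G : SimpleGraph V) (S : Finset V) :
    Gᶜ.matchingPolynomialOn S = complMatchingPolynomial (G.matchingPolynomialOn S) := by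
  classical
  induction S using Finset.strongInduction with
  | H S ih =>
    rcases S.eq_empty_or_nonempty with rfl | ⟨v, hv⟩
    · simp [matchingPolynomialOn_empty, complMatchingPolynomial_one]
    rw [matchingPolynomialOn_eq_add_sum Gᶜ hv, matchingPolynomialOn_eq_add_sum G hv, map_add,
      complMatchingPolynomial_X_zero_mul, complMatchingPolynomial_X_one_mul,
      pderiv_matchingPolynomialOn, map_sum, map_sum, ih _ (Finset.erase_ssubset hv),
      ← Finset.sum_filter_add_sum_filter_not (S.erase v) (G.Adj v)
        (fun u => complMatchingPolynomial (G.matchingPolynomialOn ((S.erase v).erase u)))]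
    have hfilter : (S.erase v).filter (Gᶜ.Adj v) = (S.erase v).filter (fun u => ¬ G.Adj v u) := by
      refine Finset.filter_congr fun u hu => ?_
      rw [compl_adj]
      exact and_iff_right (Finset.ne_of_mem_erase hu).symm
    have hsum : ∑ u ∈ S.erase v with Gᶜ.Adj v u,
        Gᶜ.matchingPolynomialOn ((S.erase v).erase u) = ∑ u ∈ S.erase v with ¬ G.Adj v u,
          complMatchingPolynomial (G.matchingPolynomialOn ((S.erase v).erase u)) := by
      rw [hfilter]
      refine Finset.sum_congr rfl fun u hu => ih _ ?_
      exact (Finset.erase_ssubset (Finset.mem_filter.1 hu).1).trans (Finset.erase_ssubset hv)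
    rw [hsum]
    ring

theorem matchingPolynomial_compl [Fintype V] (G : SimpleGraph V) :
    Gᶜ.matchingPolynomial = complMatchingPolynomial G.matchingPolynomial := by
  simp_rw [matchingPolynomial_eq_matchingPolynomialOn_univ, matchingPolynomialOn_compl]

theorem matchingPolynomialDeck_compl [Fintype V] (G : SimpleGraph V) :
    Gᶜ.matchingPolynomialDeck = G.matchingPolynomialDeck.map complMatchingPolynomial := by
  classical
  simp_rw [matchingPolynomialDeck_eq_map, matchingPolynomialOn_compl, Multiset.map_map]
  rfl

theorem matchingPolynomial_eq_of_compl_eq [Fintype V] [Fintype W]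
    {G : SimpleGraph V} {H : SimpleGraph W}
    (h : Gᶜ.matchingPolynomial = Hᶜ.matchingPolynomial) :
    G.matchingPolynomial = H.matchingPolynomial := by
  rw [← compl_compl G, ← compl_compl H, matchingPolynomial_compl Gᶜ, h,
    ← matchingPolynomial_compl]

/-! ### Paths -/

/-- The matching polynomial of the path on `n - 1` vertices, with value `0` at `n = 0`. -/
noncomputable def pathMatchingPolynomial : ℕ → MvPolynomial (Fin 2) ℤ
  | 0 => 0
  | 1 => 1
  | n + 2 => X 0 * pathMatchingPolynomial (n + 1) + X 1 * pathMatchingPolynomial n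

theorem matchingPolynomialOn_hasse_Ico (a n : ℕ) :
    (hasse ℕ).matchingPolynomialOn (Finset.Ico a (a + n)) = pathMatchingPolynomial (n + 1) := by
  classical
  induction n using Nat.strong_induction_on with
  | _ n ih =>
    match n with
    | 0 => simp [matchingPolynomialOn_empty, pathMatchingPolynomial]
    | 1 =>
      rw [matchingPolynomialOn_eq_add_sum _ (v := a) (by simp)]
      simp [matchingPolynomialOn_empty, pathMatchingPolynomial]
    | n + 2 =>
      have h1 : (Finset.Ico a (a + (n + 2))).erase (a + n + 1) = Finset.Ico a (a + (n + 1)) := by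
        ext x; simp only [Finset.mem_erase, Finset.mem_Ico]; omega
      have h2 : (Finset.Ico a (a + (n + 1))).erase (a + n) = Finset.Ico a (a + n) := by
        ext x; simp only [Finset.mem_erase, Finset.mem_Ico]; omega
      have h3 : (Finset.Ico a (a + (n + 1))).filter ((hasse ℕ).Adj (a + n + 1)) = {a + n} := by
        ext x
        simp only [Finset.mem_filter, Finset.mem_Ico, hasse_adj, Nat.covBy_iff_add_one_eq,
          Finset.mem_singleton]
        omega
      rw [matchingPolynomialOn_eq_add_sum _ (v := a + n + 1) (by simp; omega), h1, h3,
        Finset.sum_singleton, h2, ih (n + 1) (by omega), ih n (by omega)]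
      rfl

/-- Cut a path on `m + n` vertices after its first `m`: the cut edge is either unused or used. The
value `0` at index `0` covers the case of no cut edge. -/
theorem pathMatchingPolynomial_add (m n : ℕ) :
    pathMatchingPolynomial (m + n + 1) =
      pathMatchingPolynomial (m + 1) * pathMatchingPolynomial (n + 1) +
        X 1 * pathMatchingPolynomial m * pathMatchingPolynomial n := by
  induction n using Nat.strong_induction_on with
  | _ n ih =>
    match n with
    | 0 => simp [pathMatchingPolynomial]
    | 1 => simp only [pathMatchingPolynomial]; ring
    | n + 2 =>
      have e : pathMatchingPolynomial (m + (n + 2) + 1) =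
          X 0 * pathMatchingPolynomial (m + (n + 1) + 1) +
            X 1 * pathMatchingPolynomial (m + n + 1) := rfl
      rw [e, ih (n + 1) (by omega), ih n (by omega)]
      simp only [pathMatchingPolynomial]
      ring

/-- Cassini's identity: each step of the recurrence multiplies the quadratic form by `-y`. -/
theorem pathMatchingPolynomial_sq_sub (n : ℕ) :
    pathMatchingPolynomial (n + 1) ^ 2 -
        X 0 * pathMatchingPolynomial (n + 1) * pathMatchingPolynomial n -
        X 1 * pathMatchingPolynomial n ^ 2 = (-X 1) ^ n := by
  induction n with
  | zero => simp [pathMatchingPolynomial]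
  | succ n ih =>
    rw [pow_succ (-X 1), ← ih]
    simp only [pathMatchingPolynomial]
    ring

/-! ### Cycles -/

theorem _root_.Fin.sub_eq_one_iff_val_add_one_eq {n : ℕ} {a b : Fin (n + 3)}
    (ha : (a : ℕ) ≠ 0) : a - b = 1 ↔ (b : ℕ) + 1 = a := by
  rw [sub_eq_iff_eq_add', Fin.ext_iff, Fin.val_add, Fin.val_one]
  rcases Nat.lt_or_ge ((b : ℕ) + 1) (n + 3) with h | h
  · rw [Nat.mod_eq_of_lt h, eq_comm]
  · have hb : (b : ℕ) + 1 = n + 3 := by omega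
    rw [hb, Nat.mod_self]
    omega

theorem matchingPolynomialOn_cycleGraph_image_hasse {n : ℕ} (S : Finset (Fin (n + 3)))
    (hS : 0 ∉ S) :
    (cycleGraph (n + 3)).matchingPolynomialOn S =
      (hasse ℕ).matchingPolynomialOn (S.image Fin.val) := by
  refine (matchingPolynomialOn_image Fin.val S Fin.val_injective.injOn ?_).symm
  intro a ha b hb
  have ha0 : (a : ℕ) ≠ 0 := fun h => hS ((Fin.ext h : a = 0) ▸ ha)
  have hb0 : (b : ℕ) ≠ 0 := fun h => hS ((Fin.ext h : b = 0) ▸ hb)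
  rw [cycleGraph_adj, hasse_adj, Nat.covBy_iff_add_one_eq, Nat.covBy_iff_add_one_eq,
    Fin.sub_eq_one_iff_val_add_one_eq ha0, Fin.sub_eq_one_iff_val_add_one_eq hb0, or_comm]

theorem matchingPolynomialOn_cycleGraph_erase {n : ℕ} (v : Fin (n + 3)) :
    (cycleGraph (n + 3)).matchingPolynomialOn (Finset.univ.erase v) =
      pathMatchingPolynomial (n + 3) := by
  have h0 : (cycleGraph (n + 3)).matchingPolynomialOn (Finset.univ.erase 0) =
      pathMatchingPolynomial (n + 3) := by
    rw [matchingPolynomialOn_cycleGraph_image_hasse _ (by simp),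
      ← matchingPolynomialOn_hasse_Ico 1 (n + 2)]
    congr 1
    ext x
    simp only [Finset.mem_image, Finset.mem_erase, Finset.mem_univ, and_true, Finset.mem_Ico]
    constructor
    · rintro ⟨a, ha, rfl⟩
      have := Fin.val_ne_zero_iff.2 ha
      omega
    · intro hx
      exact ⟨⟨x, by omega⟩, by rw [← Fin.val_ne_zero_iff]; simp; omega, rfl⟩
  -- The rotation by `v` reduces deletion of `v` to deletion of `0`, where no edge wraps around.
  rw [← h0, ← matchingPolynomialOn_image (H := cycleGraph (n + 3)) (· + v)
    (Finset.univ.erase (0 : Fin (n + 3))) (add_left_injective v).injOn]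
  · congr 1
    ext w
    simp only [Finset.mem_image, Finset.mem_erase, Finset.mem_univ, and_true, ne_eq]
    constructor
    · exact fun h => ⟨w - v, sub_ne_zero.2 h, sub_add_cancel w v⟩
    · rintro ⟨a, ha, rfl⟩
      simpa using ha
  · intro a _ b _
    simp only [cycleGraph_adj, add_sub_add_right_eq_sub]

theorem matchingPolynomial_cycleGraph (n : ℕ) :
    (cycleGraph (n + 3)).matchingPolynomial =
      X 0 * pathMatchingPolynomial (n + 3) + 2 * X 1 * pathMatchingPolynomial (n + 2) := by
  classical
  have hne : (1 : Fin (n + 3)) ≠ Fin.last (n + 2) := by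
    simp [Fin.ext_iff]
  have hlast : (Fin.last (n + 2)) ≠ 0 := by simp [Fin.ext_iff]
  have hfilter : (Finset.univ.erase (0 : Fin (n + 3))).filter ((cycleGraph (n + 3)).Adj 0) =
      {1, Fin.last (n + 2)} := by
    ext x
    have hx : -x = 1 ↔ x = Fin.last (n + 2) := by
      rw [← Fin.neg_last, neg_inj]
    simp only [Finset.mem_filter, Finset.mem_erase, Finset.mem_univ, and_true, cycleGraph_adj,
      Finset.mem_insert, Finset.mem_singleton, zero_sub, sub_zero, hx]
    constructor
    · exact fun h => h.2.symm
    · rintro (rfl | rfl)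
      · simp
      · exact ⟨hlast, Or.inl rfl⟩
  have h1 : (cycleGraph (n + 3)).matchingPolynomialOn ((Finset.univ.erase 0).erase 1) =
      pathMatchingPolynomial (n + 2) := by
    rw [matchingPolynomialOn_cycleGraph_image_hasse _ (by simp),
      ← matchingPolynomialOn_hasse_Ico 2 (n + 1)]
    congr 1
    ext x
    simp only [Finset.mem_image, Finset.mem_erase, Finset.mem_univ, and_true, Finset.mem_Ico,
      ne_eq, Fin.ext_iff, Fin.val_one, Fin.val_zero]
    constructor
    · rintro ⟨a, ha, rfl⟩
      omega
    · intro hx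
      exact ⟨⟨x, by omega⟩, by simp; omega, rfl⟩
  have h2 : (cycleGraph (n + 3)).matchingPolynomialOn
      ((Finset.univ.erase 0).erase (Fin.last (n + 2))) = pathMatchingPolynomial (n + 2) := by
    rw [matchingPolynomialOn_cycleGraph_image_hasse _ (by simp),
      ← matchingPolynomialOn_hasse_Ico 1 (n + 1)]
    congr 1
    ext x
    simp only [Finset.mem_image, Finset.mem_erase, Finset.mem_univ, and_true, Finset.mem_Ico,
      ne_eq, Fin.ext_iff, Fin.val_last, Fin.val_zero]
    constructor
    · rintro ⟨a, ha, rfl⟩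
      omega
    · intro hx
      exact ⟨⟨x, by omega⟩, by simp; omega, rfl⟩
  rw [matchingPolynomial_eq_matchingPolynomialOn_univ,
    matchingPolynomialOn_eq_add_sum _ (Finset.mem_univ 0), hfilter, Finset.sum_pair hne, h1, h2,
    matchingPolynomialOn_cycleGraph_erase]
  ring

/-! ### Fibonacci–Lucas identities and the comparison of `C_{2k}` with `C_k ⊔ C_k` -/

theorem pathMatchingPolynomial_two_mul (m : ℕ) :
    pathMatchingPolynomial (2 * (m + 3)) =
      (cycleGraph (m + 3)).matchingPolynomial * pathMatchingPolynomial (m + 3) := by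
  have h : 2 * (m + 3) = (m + 3) + (m + 2) + 1 := by ring
  rw [h, pathMatchingPolynomial_add, matchingPolynomial_cycleGraph]
  simp only [pathMatchingPolynomial]
  ring

theorem matchingPolynomial_cycleGraph_sq (m : ℕ) :
    (cycleGraph (m + 3)).matchingPolynomial ^ 2 =
      (cycleGraph (2 * (m + 3))).matchingPolynomial + 2 * (-X 1) ^ (m + 3) := by
  have hodd : pathMatchingPolynomial (2 * m + 3 + 2) = pathMatchingPolynomial (m + 3) ^ 2 +
      X 1 * pathMatchingPolynomial (m + 2) ^ 2 := by
    rw [show 2 * m + 3 + 2 = (m + 2) + (m + 2) + 1 by ring, pathMatchingPolynomial_add]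
    ring
  have hcycle : (cycleGraph (2 * (m + 3))).matchingPolynomial =
      X 0 * pathMatchingPolynomial (2 * (m + 3)) +
        2 * X 1 * pathMatchingPolynomial (2 * m + 3 + 2) :=
    matchingPolynomial_cycleGraph (2 * m + 3)
  -- One factor `-y` is split off so that Cassini's identity applies at index `m + 2`.
  rw [pow_succ (-X 1) (m + 2), ← pathMatchingPolynomial_sq_sub, hcycle, hodd,
    pathMatchingPolynomial_two_mul, matchingPolynomial_cycleGraph]
  ring

theorem matchingPolynomial_cycleGraph_two_mul_ne {k : ℕ} (hk : 3 ≤ k) :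
    (cycleGraph (2 * k)).matchingPolynomial ≠
      (cycleGraph k ⊕g cycleGraph k).matchingPolynomial := by
  obtain ⟨m, rfl⟩ := Nat.exists_eq_add_of_le' hk
  rw [matchingPolynomial_sum, ← sq, matchingPolynomial_cycleGraph_sq, ne_eq, left_eq_add]
  exact mul_ne_zero two_ne_zero (pow_ne_zero _ (neg_ne_zero.2 (X_ne_zero _)))

theorem matchingPolynomialDeck_cycleGraph_two_mul {k : ℕ} (hk : 3 ≤ k) :
    (cycleGraph (2 * k)).matchingPolynomialDeck =
      (cycleGraph k ⊕g cycleGraph k).matchingPolynomialDeck := by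
  obtain ⟨m, rfl⟩ := Nat.exists_eq_add_of_le' hk
  have h : ∀ v : Fin (2 * (m + 3)),
      (cycleGraph (2 * (m + 3))).matchingPolynomialOn (Finset.univ.erase v) =
        pathMatchingPolynomial (2 * (m + 3)) :=
    matchingPolynomialOn_cycleGraph_erase (n := 2 * m + 3)
  have h' : ∀ v : Fin (m + 3) ⊕ Fin (m + 3),
      (cycleGraph (m + 3) ⊕g cycleGraph (m + 3)).matchingPolynomialOn (Finset.univ.erase v) =
        pathMatchingPolynomial (2 * (m + 3)) := by
    rw [pathMatchingPolynomial_two_mul, matchingPolynomial_eq_matchingPolynomialOn_univ]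
    rintro (v | v)
    · rw [mul_comm, ← matchingPolynomialOn_cycleGraph_erase v, ← matchingPolynomialOn_sum]
      congr 1
      ext (a | a) <;> simp
    · rw [← matchingPolynomialOn_cycleGraph_erase v, ← matchingPolynomialOn_sum]
      congr 1
      ext (a | a) <;> simp
  rw [matchingPolynomialDeck_eq_map, matchingPolynomialDeck_eq_map]
  simp_rw [h, h', Multiset.map_const', Finset.card_val, Finset.card_univ, Fintype.card_sum,
    Fintype.card_fin, two_mul]

end SimpleGraph

open SimpleGraph in
theorem mainTheorem3 (k : ℕ) (hk : 3 ≤ k) :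
    ((cycleGraph (2 * k)).matchingPolynomialDeck =
        (cycleGraph k ⊕g cycleGraph k).matchingPolynomialDeck ∧
      (cycleGraph (2 * k)).matchingPolynomial ≠
        (cycleGraph k ⊕g cycleGraph k).matchingPolynomial) ∧
    ((cycleGraph (2 * k))ᶜ.matchingPolynomialDeck =
        (cycleGraph k ⊕g cycleGraph k)ᶜ.matchingPolynomialDeck ∧
      (cycleGraph (2 * k))ᶜ.matchingPolynomial ≠
        (cycleGraph k ⊕g cycleGraph k)ᶜ.matchingPolynomial) ∧
    ¬ (cycleGraph (2 * k)).IsMatchingPolynomialReconstructible ∧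
    ¬ (cycleGraph k ⊕g cycleGraph k).IsMatchingPolynomialReconstructible ∧
    ¬ (cycleGraph (2 * k))ᶜ.IsMatchingPolynomialReconstructible ∧
    ¬ (cycleGraph k ⊕g cycleGraph k)ᶜ.IsMatchingPolynomialReconstructible := by
  have hdeck := matchingPolynomialDeck_cycleGraph_two_mul hk
  have hne := matchingPolynomial_cycleGraph_two_mul_ne hk
  have hdeck' : (cycleGraph (2 * k))ᶜ.matchingPolynomialDeck =
      (cycleGraph k ⊕g cycleGraph k)ᶜ.matchingPolynomialDeck := by
    rw [matchingPolynomialDeck_compl, matchingPolynomialDeck_compl, hdeck]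
  have hne' : (cycleGraph (2 * k))ᶜ.matchingPolynomial ≠
      (cycleGraph k ⊕g cycleGraph k)ᶜ.matchingPolynomial :=
    fun h => hne (matchingPolynomial_eq_of_compl_eq h)
  exact ⟨⟨hdeck, hne⟩, ⟨hdeck', hne'⟩, fun h => hne (h _ _ hdeck.symm).symm,
    fun h => hne (h _ _ hdeck), fun h => hne' (h _ _ hdeck'.symm).symm,
    fun h => hne' (h _ _ hdeck')⟩
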